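/- Consider $n$ agents with positions $x_p(t)\in\mathbb{R}^d$. A communication graph is a directed graph on the agents with a self-loop at every node; $\mathrm{In}_p(t)$ denotes the set of in-neighbors of $p$ in the communication graph $G_t$ of round $t\ge 1$. In each round $t$, every agent $p$ receives the states of its in-neighbors in $G_t$ and updates its own state (which determines its position) by a local rule, possibly non-deterministic. A *convex combination algorithm* is one in which, for all communication patterns $(G_t)_{t\ge1}$, in every execution, round $t\geq 1$ and agent $p$, $$x_p(t)=\sum_{q\in \mathrm{In}_p(t)} w_{pq}(t)\,x_q(t-1),\qquad w_{pq}(t)\ge 0,\quad \sum_{q\in \mathrm{In}_p(t)} w_{pq}(t)=1 .$$ It is *$\alpha$-safe* if, for all communication patterns, in every execution, for all $t\ge 0$, all agents $p$ and all components $i\in\{1,\dots,d\}$, $$\alpha M_{p,i}(t)+(1-\alpha)m_{p,i}(t)\le x_{p,i}(t+1)\le (1-\alpha)M_{p,i}(t)+\alpha\, m_{p,i}(t),$$ where $m_{p,i}(t)$ and $M_{p,i}(t)$ are the minimum and the maximum of $x_{q,i}(t)$ over $q\in \mathrm{In}_p(t+1)$. An execution *achieves asymptotic consensus* if each sequence $x_p(t)$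 converges as $t\to\infty$, all these limits are equal, and the limit lies in the convex hull of the initial positions $x_q(0)$. **Theorem.** Let $0<\alpha\le 1/2$, let $d$ be any dimension, and take any $\alpha$-safe convex combination algorithm in $\mathbb{R}^d$. Asymptotic consensus is achieved in each of its executions in which all communication graphs $G_t$ are bidirectional (if $(p,q)$ is an edge then so is $(q,p)$) and the agents are infinitely often connected (the directed graph formed by the edges that occur in $G_t$ for infinitely many $t$ is strongly connected). This covers the following two algorithms, which consequently achieve asymptotic consensus in all such executions: * the *ExtremePoint* algorithm, which is a $\frac{1}{2d}$-safe convex combination algorithm: for each component $i$, each agent selects among the positions of its in-neighbors one with minimal and one with maximal $i$-th component, and it moves to the average of these $2d$ positions (counted with multiplicity); * the *Centroid* algorithm, which is a $\frac{1}{d+1}$-safe convex combination algorithm: each agent moves to the centroid of the convex hull of the positions of its in-neighbors, with uniform mass distribution on this hull (with respect to $k$-dimensional volume, where $k$ is the dimension of the hull). -/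

import Mathlib

universe u

namespace Consensus

open Filter Topology MeasureTheory

/-- Euclidean `d`-space. -/
abbrev Space (d : ℕ) : Type := EuclideanSpace ℝ (Fin d)

/-- A communication graph on the agents `Fin n`: a directed graph with a self-loop at each node.
`G.Adj q p` means that `p` receives the message of `q`. -/
structure CommGraph (n : ℕ) extends Digraph (Fin n) where
  self_loop : ∀ p, Adj p p

/-- The set of in-neighbors of agent `p`. -/
noncomputable def CommGraph.inNeighbors {n : ℕ} (G : CommGraph n) (p : Fin n) :
    Finset (Fin n) :=
  open Classical in Finset.univ.filter fun q => G.Adj q p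

theorem CommGraph.inNeighbors_nonempty {n : ℕ} (G : CommGraph n) (p : Fin n) :
    (G.inNeighbors p).Nonempty :=
  ⟨p, by simp [CommGraph.inNeighbors, G.self_loop p]⟩

/-- A directed graph is bidirectional if the reverse of each edge is an edge. -/
def Bidirectional {V : Type*} (G : Digraph V) : Prop :=
  ∀ p q, G.Adj p q → G.Adj q p

/-- A directed graph is strongly connected if there is a directed path from each node to each
node. -/
def StronglyConnected {V : Type*} (G : Digraph V) : Prop :=
  ∀ p q, Relation.ReflTransGen G.Adj p q

/-- A communication pattern: `G t` is the communication graph at round `t`, for `t ≥ 1`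
(the value `G 0` is never used). -/
abbrev Pattern (n : ℕ) : Type := ℕ → CommGraph n

/-- The directed graph of the edges that occur infinitely often. -/
def Pattern.limitGraph {n : ℕ} (G : Pattern n) : Digraph (Fin n) where
  Adj p q := ∃ᶠ t in atTop, (G t).Adj p q

/-- The agents are infinitely often connected. -/
def Pattern.InfinitelyOftenConnected {n : ℕ} (G : Pattern n) : Prop :=
  StronglyConnected G.limitGraph

/-- A round-based distributed algorithm for `n` agents with positions in Euclidean `d`-space.
Each agent has a local state, which determines its position. In round `t`, agent `p` receives the
states of its in-neighbors and moves to a new state, which is one of the elements of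
`next t p S m`, where `S` is the set of in-neighbors of `p` and `m` is the family of received
states. Thus the update is local, and it is deterministic if the sets `next t p S m` are
singletons. -/
structure Algorithm (n d : ℕ) where
  State : Type u
  position : State → Space d
  init : Fin n → Set State
  next : ℕ → Fin n → (S : Finset (Fin n)) → (S → State) → Set State

/-- `s` is an execution of `A` with communication pattern `G`, where `s t p` is the state of
agent `p` at the end of round `t`. -/
def Algorithm.IsExecution {n d : ℕ} (A : Algorithm.{u} n d) (G : Pattern n)
    (s : ℕ → Fin n → A.State) : Prop :=
  (∀ p, s 0 p ∈ A.init p) ∧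
  ∀ t p, s (t + 1) p ∈ A.next (t + 1) p ((G (t + 1)).inNeighbors p) fun q => s t q

/-- In round `t + 1`, with communication graph `G`, each agent moves from its position in `x` to a
convex combination (its position in `y`) of the positions of its in-neighbors. -/
def ConvexStep {n d : ℕ} (G : CommGraph n) (x y : Fin n → Space d) : Prop :=
  ∀ p, ∃ w : Fin n → ℝ, (∀ q ∈ G.inNeighbors p, 0 ≤ w q) ∧
    ∑ q ∈ G.inNeighbors p, w q = 1 ∧ y p = ∑ q ∈ G.inNeighbors p, w q • x q

/-- The minimum of the `i`-th components of the positions of the in-neighbors of `p`. -/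
noncomputable def minIn {n d : ℕ} (G : CommGraph n) (x : Fin n → Space d) (p : Fin n)
    (i : Fin d) : ℝ :=
  (G.inNeighbors p).inf' (G.inNeighbors_nonempty p) fun q => x q i

/-- The maximum of the `i`-th components of the positions of the in-neighbors of `p`. -/
noncomputable def maxIn {n d : ℕ} (G : CommGraph n) (x : Fin n → Space d) (p : Fin n)
    (i : Fin d) : ℝ :=
  (G.inNeighbors p).sup' (G.inNeighbors_nonempty p) fun q => x q i

/-- The safeness inequalities, in each component, for a round with communication graph `G` that
takes the positions `x` to the positions `y`. -/
def SafeStep {n d : ℕ} (α : ℝ) (G : CommGraph n) (x y : Fin n → Space d) : Prop :=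
  ∀ p i, α * maxIn G x p i + (1 - α) * minIn G x p i ≤ y p i ∧
    y p i ≤ (1 - α) * maxIn G x p i + α * minIn G x p i

/-- The positions of the agents along a sequence of states. -/
def Algorithm.positions {n d : ℕ} (A : Algorithm.{u} n d) (s : ℕ → Fin n → A.State) :
    ℕ → Fin n → Space d :=
  fun t p => A.position (s t p)

/-- `A` is a convex combination algorithm. -/
def Algorithm.IsConvexCombination {n d : ℕ} (A : Algorithm.{u} n d) : Prop :=
  ∀ (G : Pattern n) (s : ℕ → Fin n → A.State), A.IsExecution G s →
    ∀ t, ConvexStep (G (t + 1)) (A.positions s t) (A.positions s (t + 1))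

/-- `A` is `α`-safe. -/
def Algorithm.IsSafe {n d : ℕ} (A : Algorithm.{u} n d) (α : ℝ) : Prop :=
  ∀ (G : Pattern n) (s : ℕ → Fin n → A.State), A.IsExecution G s →
    ∀ t, SafeStep α (G (t + 1)) (A.positions s t) (A.positions s (t + 1))

/-- Asymptotic consensus for a sequence of configurations: convergence, agreement, validity. -/
def AsymptoticConsensus {n d : ℕ} (x : ℕ → Fin n → Space d) : Prop :=
  (∀ p, ∃ l, Tendsto (fun t => x t p) atTop (𝓝 l)) ∧
  (∀ p q l l', Tendsto (fun t => x t p) atTop (𝓝 l) →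
    Tendsto (fun t => x t q) atTop (𝓝 l') → l = l') ∧
  (∀ p l, Tendsto (fun t => x t p) atTop (𝓝 l) → l ∈ convexHull ℝ (Set.range (x 0)))

/-- `A` achieves asymptotic consensus in each of its executions in which all communication graphs
are bidirectional and the agents are infinitely often connected. -/
def Algorithm.AchievesConsensusBidirectional {n d : ℕ} (A : Algorithm.{u} n d) : Prop :=
  ∀ (G : Pattern n) (s : ℕ → Fin n → A.State), A.IsExecution G s →
    (∀ t, 1 ≤ t → Bidirectional (G t).toDigraph) → G.InfinitelyOftenConnected →
    AsymptoticConsensus (A.positions s)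

/-- The ExtremePoint algorithm: for each component `i`, the agent selects, among the received
positions, a position `x (a i)` with minimal and a position `x (b i)` with maximal `i`-th
component, and it moves to the average of these `2 d` positions. The selection is arbitrary. -/
noncomputable def extremePoint (n d : ℕ) : Algorithm.{0} n d where
  State := Space d
  position := id
  init _ := Set.univ
  next _ _ S x := {y | ∃ a b : Fin d → S,
    (∀ i q, x (a i) i ≤ x q i) ∧ (∀ i q, x q i ≤ x (b i) i) ∧
    y = (1 / (2 * d : ℝ)) • (∑ i, x (a i) + ∑ i, x (b i))}

/-- The centroid of a convex set `C`, with uniform mass distribution on `C`: the mean of the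
points of `C` with respect to `k`-dimensional volume, where `k` is the dimension of the affine
span of `C`. -/
noncomputable def uniformCentroid {d : ℕ} (C : Set (Space d)) : Space d :=
  ⨍ z in C, z ∂(Measure.hausdorffMeasure (Module.finrank ℝ (vectorSpan ℝ C) : ℝ))

/-- The Centroid algorithm: the agent moves to the centroid of the convex hull of the received
positions. -/
noncomputable def centroidAlgorithm (n d : ℕ) : Algorithm.{0} n d where
  State := Space d
  position := id
  init _ := Set.univ
  next _ _ _ x := {uniformCentroid (convexHull ℝ (Set.range x))}

end Consensus

/-! Each coordinate is treated separately. Let `U` bound all values at some time and let `S` be a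
set of agents with values at most `c ≤ U`. Until the first later round with an edge leaving `S`,
bidirectionality forbids edges entering `S`, so its values stay at most `c`. In that round each
agent of `S` (by its self-loop) and the receiver outside `S` hear a value at most `c`, so by
safeness they end at most `U - α * (U - c)`. Thus `S` grows while the gap to `U` loses only a factor
`α` (`ContractsAbove.exists_ssubset`). Starting from an agent with minimal value, the spread
eventually shrinks by the factor `1 - α ^ n`, however long the waiting times
(`ContractsAbove.exists_tendsto`).

Safeness of ExtremePoint is a count of the selected points. For Centroid, homotheties about a
minimizer of a linear functional bound its superlevel sets of distance to the maximum, and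
integrating over the levels gives `1 / (k + 1)` for a `k`-dimensional hull (`le_setIntegral_sub`).
-/

namespace Consensus

open Filter Topology MeasureTheory

/-! ### Contraction of scalar values -/

/-- Agent values that stay a fraction `α` of the way from any upper bound of the received values
towards each received value. -/
def ContractsAbove {n : ℕ} (α : ℝ) (G : Pattern n) (y : ℕ → Fin n → ℝ) : Prop :=
  ∀ t p q U, (G (t + 1)).Adj q p → (∀ r, (G (t + 1)).Adj r p → y t r ≤ U) →
    y (t + 1) p ≤ (1 - α) * U + α * y t q

/-- Only the in-neighbors of `p` need to be bounded, so this also applies inside a set of agents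
that no edge enters. -/
theorem ContractsAbove.le_of_forall_le {n : ℕ} {α : ℝ} {G : Pattern n} {y : ℕ → Fin n → ℝ}
    (hy : ContractsAbove α G y) (hα : 0 ≤ α) {t : ℕ} {p : Fin n} {U : ℝ}
    (hU : ∀ r, (G (t + 1)).Adj r p → y t r ≤ U) : y (t + 1) p ≤ U := by
  have h1 := hy t p p U ((G (t + 1)).self_loop p) hU
  have h2 := hU p ((G (t + 1)).self_loop p)
  nlinarith

theorem ContractsAbove.le_of_le {n : ℕ} {α : ℝ} {G : Pattern n} {y : ℕ → Fin n → ℝ}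
    (hy : ContractsAbove α G y) (hα : 0 ≤ α) {s t : ℕ} (hst : s ≤ t) {U : ℝ}
    (hU : ∀ r, y s r ≤ U) (p : Fin n) : y t p ≤ U := by
  induction t, hst using Nat.le_induction generalizing p with
  | base => exact hU p
  | succ t _ ih => exact hy.le_of_forall_le hα fun r _ => ih r

/-- A path of recurring edges from inside `S` to outside must use an edge that leaves `S`, and this
edge occurs again after any time `t`. -/
theorem exists_crossing {n : ℕ} {G : Pattern n} (hG : G.InfinitelyOftenConnected)
    {S : Finset (Fin n)} (hS : S.Nonempty) (hS' : S ≠ Finset.univ) (t : ℕ) :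
    ∃ k, ∃ a ∈ S, ∃ b ∉ S, (G (t + k + 1)).Adj a b := by
  obtain ⟨a, ha⟩ := hS
  obtain ⟨b, hb⟩ : ∃ b, b ∉ S := by
    by_contra! h
    exact hS' (Finset.eq_univ_iff_forall.2 h)
  have key : ∃ c ∈ S, ∃ e ∉ S, G.limitGraph.Adj c e := by
    by_contra! h
    have : ∀ c, Relation.ReflTransGen G.limitGraph.Adj a c → c ∈ S := by
      intro c hc
      induction hc with
      | refl => exact ha
      | tail _ hbc ih =>
        by_contra hcS
        exact h _ ih _ hcS hbc
    exact hb (this b (hG a b))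
  obtain ⟨c, hc, e, he, hce⟩ := key
  obtain ⟨m, hm, hadj⟩ := frequently_atTop.1 hce (t + 1)
  obtain ⟨k, rfl⟩ := Nat.exists_eq_add_of_le hm
  refine ⟨k, c, hc, e, he, ?_⟩
  rwa [show t + k + 1 = t + 1 + k by ring]

/-- The set of agents below a level grows, at the price of a level closer to the upper bound. -/
theorem ContractsAbove.exists_ssubset {n : ℕ} {α : ℝ} {G : Pattern n} {y : ℕ → Fin n → ℝ}
    (hy : ContractsAbove α G y) (hα : 0 ≤ α)
    (hB : ∀ t, 1 ≤ t → Bidirectional (G t).toDigraph) (hG : G.InfinitelyOftenConnected)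
    {t : ℕ} {U c : ℝ} (hU : ∀ r, y t r ≤ U) {S : Finset (Fin n)}
    (hS : S.Nonempty) (hS' : S ≠ Finset.univ) (hSc : ∀ p ∈ S, y t p ≤ c) :
    ∃ t' ≥ t, ∃ S', S ⊂ S' ∧ ∀ p ∈ S', y t' p ≤ U - α * (U - c) := by
  classical
  have hex := exists_crossing hG hS hS' t
  -- The first crossing round is `t + k + 1`; no edge leaves `S` in the rounds between.
  set k := Nat.find hex with hk
  obtain ⟨a, ha, b, hb, hab⟩ := Nat.find_spec hex
  rw [← hk] at hab
  have hstay : ∀ j ≤ k, ∀ p ∈ S, y (t + j) p ≤ c := by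
    intro j
    induction j with
    | zero => exact fun _ => hSc
    | succ j ih =>
      intro hj p hp
      refine hy.le_of_forall_le hα fun r hr => ih (by omega) r ?_
      -- The reverse of an edge entering `S` would be an earlier crossing.
      by_contra hrS
      exact Nat.find_min hex (m := j) (by omega)
        ⟨p, hp, r, hrS, hB _ (by omega) _ _ hr⟩
  have hUk := hy.le_of_le hα (show t ≤ t + k by omega) hU
  have hrecv : ∀ p, ∀ q ∈ S, (G (t + k + 1)).Adj q p → y (t + k + 1) p ≤ U - α * (U - c) := by
    intro p q hq hadj
    have h1 := hy (t + k) p q U hadj fun r _ => hUk r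
    have h2 := hstay k le_rfl q hq
    nlinarith
  refine ⟨t + k + 1, by omega, insert b S, Finset.ssubset_insert hb, fun p hp => ?_⟩
  rcases Finset.mem_insert.1 hp with rfl | hp
  · exact hrecv _ a ha hab
  · exact hrecv p p hp ((G _).self_loop p)

/-- Here `k` bounds the number of agents outside `S`. Each growth step replaces `U - c` by `α * (U -
c)`, so at most `k` factors `α` are lost. -/
theorem ContractsAbove.exists_forall_le {n : ℕ} {α : ℝ} {G : Pattern n} {y : ℕ → Fin n → ℝ}
    (hy : ContractsAbove α G y) (hα : 0 ≤ α) (hα' : α ≤ 1)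
    (hB : ∀ t, 1 ≤ t → Bidirectional (G t).toDigraph) (hG : G.InfinitelyOftenConnected)
    {U : ℝ} (k : ℕ) : ∀ {t : ℕ} {c : ℝ}, (∀ r, y t r ≤ U) → c ≤ U → ∀ {S : Finset (Fin n)},
    S.Nonempty → n ≤ S.card + k → (∀ p ∈ S, y t p ≤ c) →
    ∃ t' ≥ t, ∀ p, y t' p ≤ U - α ^ k * (U - c) := by
  induction k with
  | zero =>
    intro t c _ _ S _ hcard hSc
    have hSu : S = Finset.univ := by
      rw [← Finset.card_eq_iff_eq_univ, Fintype.card_fin]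
      have := Finset.card_le_univ S
      simp only [Fintype.card_fin] at this
      omega
    exact ⟨t, le_rfl, fun p => by simpa using hSc p (by simp [hSu])⟩
  | succ k ih =>
    intro t c hU hc S hS hcard hSc
    have hpow : α ^ (k + 1) ≤ 1 := pow_le_one₀ hα hα'
    by_cases hSu : S = Finset.univ
    · refine ⟨t, le_rfl, fun p => ?_⟩
      have := hSc p (by simp [hSu])
      nlinarith
    · obtain ⟨t₁, ht₁, S', hSS', hS'⟩ := hy.exists_ssubset hα hB hG hU hS hSu hSc
      have := Finset.card_lt_card hSS'
      obtain ⟨t₂, ht₂, h⟩ := ih (hy.le_of_le hα ht₁ hU)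
        (by nlinarith : U - α * (U - c) ≤ U) (hS.mono hSS'.1) (by omega) hS'
      refine ⟨t₂, ht₁.trans ht₂, fun p => (h p).trans (le_of_eq ?_)⟩
      ring

/-- Scalar values that contract in both directions converge to a common limit. -/
theorem ContractsAbove.exists_tendsto {n : ℕ} {α : ℝ} {G : Pattern n} {y : ℕ → Fin n → ℝ}
    (hy : ContractsAbove α G y) (hy' : ContractsAbove α G (-y)) (hα : 0 < α) (hα' : α ≤ 1)
    (hB : ∀ t, 1 ≤ t → Bidirectional (G t).toDigraph) (hG : G.InfinitelyOftenConnected) :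
    ∃ l, ∀ p, Tendsto (fun t => y t p) atTop (𝓝 l) := by
  rcases Nat.eq_zero_or_pos n with rfl | hn
  · exact ⟨0, fun p => p.elim0⟩
  have : Nonempty (Fin n) := ⟨⟨0, hn⟩⟩
  have hne : (Finset.univ : Finset (Fin n)).Nonempty := Finset.univ_nonempty
  set M : ℕ → ℝ := fun t => Finset.univ.sup' hne (y t)
  set m : ℕ → ℝ := fun t => Finset.univ.inf' hne (y t)
  have hM : ∀ t p, y t p ≤ M t := fun t p => Finset.le_sup' (y t) (Finset.mem_univ p)
  have hm : ∀ t p, m t ≤ y t p := fun t p => Finset.inf'_le (y t) (Finset.mem_univ p)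
  have hMa : Antitone M := fun s t hst =>
    Finset.sup'_le _ _ fun p _ => hy.le_of_le hα.le hst (hM s) p
  have hmm : Monotone m := fun s t hst =>
    Finset.le_inf' _ _ fun p _ => by
      have := hy'.le_of_le hα.le hst (U := -m s) (fun r => neg_le_neg (hm s r)) p
      simpa using this
  have hmM : ∀ t, m t ≤ M t := fun t =>
    (hm t (Classical.arbitrary _)).trans (hM t _)
  -- It suffices that the maximum drops, since the minimum never decreases.
  have hshrink : ∀ t, ∃ t', M t' - m t' ≤ (1 - α ^ n) * (M t - m t) := by
    intro t
    obtain ⟨p, -, hp⟩ := Finset.exists_mem_eq_inf' hne (y t)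
    obtain ⟨t', ht', h⟩ := hy.exists_forall_le hα.le hα' hB hG n (hM t) (hmM t)
      (Finset.singleton_nonempty p) (by simp) (fun q hq => by rw [Finset.mem_singleton.1 hq]; exact hp.ge)
    refine ⟨t', ?_⟩
    have h1 : M t' ≤ M t - α ^ n * (M t - m t) := Finset.sup'_le _ _ fun p _ => h p
    have h2 := hmm ht'
    linarith
  have hMb : BddBelow (Set.range M) :=
    ⟨m 0, by rintro _ ⟨t, rfl⟩; exact (hmm (Nat.zero_le t)).trans (hmM t)⟩
  have hmb : BddAbove (Set.range m) :=
    ⟨M 0, by rintro _ ⟨t, rfl⟩; exact (hmM t).trans (hMa (Nat.zero_le t))⟩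
  have hMl := tendsto_atTop_ciInf hMa hMb
  have hml := tendsto_atTop_ciSup hmm hmb
  have hlow : ∀ t, (⨅ t, M t) - (⨆ t, m t) ≤ M t - m t := by
    intro t
    exact sub_le_sub (ciInf_le hMb t) (le_ciSup hmb t)
  have heq : (⨅ t, M t) = ⨆ t, m t := by
    refine le_antisymm ?_ (le_of_tendsto_of_tendsto' hml hMl hmM)
    have hlim : Tendsto (fun t => (1 - α ^ n) * (M t - m t)) atTop
        (𝓝 ((1 - α ^ n) * ((⨅ t, M t) - ⨆ t, m t))) := (hMl.sub hml).const_mul _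
    -- The limit spread `D ≥ 0` satisfies `D ≤ (1 - α ^ n) * D`, hence vanishes.
    have := ge_of_tendsto' hlim fun t => by
      obtain ⟨t', ht'⟩ := hshrink t
      exact (hlow t').trans ht'
    have hpos : 0 < α ^ n := pow_pos hα n
    nlinarith
  refine ⟨⨅ t, M t, fun p => ?_⟩
  exact tendsto_of_tendsto_of_tendsto_of_le_of_le (heq ▸ hml) hMl (fun t => hm t p)
    fun t => hM t p

/-! ### From safeness to consensus in all components -/

theorem SafeStep.contractsAbove {n d : ℕ} {α : ℝ} (hα : 0 ≤ α) (hα' : α ≤ 1) {G : Pattern n}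
    {x : ℕ → Fin n → Space d} (h : ∀ t, SafeStep α (G (t + 1)) (x t) (x (t + 1))) (i : Fin d) :
    ContractsAbove α G fun t p => x t p i := by
  intro t p q U hq hU
  have h1 : maxIn (G (t + 1)) (x t) p i ≤ U :=
    Finset.sup'_le _ _ fun r hr => hU r (by simpa [CommGraph.inNeighbors] using hr)
  have h2 : minIn (G (t + 1)) (x t) p i ≤ x t q i :=
    Finset.inf'_le (fun q => x t q i) (by simpa [CommGraph.inNeighbors] using hq)
  refine ((h t p i).2).trans ?_
  gcongr

theorem SafeStep.contractsAbove_neg {n d : ℕ} {α : ℝ} (hα : 0 ≤ α) (hα' : α ≤ 1) {G : Pattern n}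
    {x : ℕ → Fin n → Space d} (h : ∀ t, SafeStep α (G (t + 1)) (x t) (x (t + 1))) (i : Fin d) :
    ContractsAbove α G (-fun t p => x t p i) := by
  intro t p q U hq hU
  have h1 : -U ≤ minIn (G (t + 1)) (x t) p i :=
    Finset.le_inf' _ _ fun r hr =>
      neg_le.1 (hU r (by simpa [CommGraph.inNeighbors] using hr))
  have h2 : x t q i ≤ maxIn (G (t + 1)) (x t) p i :=
    Finset.le_sup' (fun q => x t q i) (by simpa [CommGraph.inNeighbors] using hq)
  have h3 := (h t p i).1
  simp only [Pi.neg_apply]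
  nlinarith [mul_nonneg hα (sub_nonneg.2 h2), mul_nonneg (sub_nonneg.2 hα') (sub_nonneg.2 h1)]

theorem ConvexStep.mem_convexHull {n d : ℕ} {G : CommGraph n} {x y : Fin n → Space d}
    (h : ConvexStep G x y) (p : Fin n) : y p ∈ convexHull ℝ (Set.range x) := by
  obtain ⟨w, hw, hw1, hy⟩ := h p
  rw [hy]
  exact (convex_convexHull ℝ _).sum_mem hw hw1
    fun q _ => subset_convexHull ℝ _ (Set.mem_range_self q)

theorem asymptoticConsensus_of_safe {n d : ℕ} {α : ℝ} (hα : 0 < α) (hα' : α ≤ 1) {G : Pattern n}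
    {x : ℕ → Fin n → Space d} (hC : ∀ t, ConvexStep (G (t + 1)) (x t) (x (t + 1)))
    (hS : ∀ t, SafeStep α (G (t + 1)) (x t) (x (t + 1)))
    (hB : ∀ t, 1 ≤ t → Bidirectional (G t).toDigraph) (hG : G.InfinitelyOftenConnected) :
    AsymptoticConsensus x := by
  choose l hl using fun i => (SafeStep.contractsAbove hα.le hα' hS i).exists_tendsto
    (SafeStep.contractsAbove_neg hα.le hα' hS i) hα hα' hB hG
  have hlim : ∀ p, Tendsto (fun t => x t p) atTop (𝓝 (WithLp.toLp 2 l)) := by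
    intro p
    have h1 : Tendsto (fun t => WithLp.ofLp (x t p)) atTop (𝓝 l) :=
      tendsto_pi_nhds.2 fun i => hl i p
    exact ((PiLp.continuous_toLp 2 _).tendsto l).comp h1
  have hhull : ∀ t p, x t p ∈ convexHull ℝ (Set.range (x 0)) := by
    intro t
    induction t with
    | zero => exact fun p => subset_convexHull ℝ _ (Set.mem_range_self p)
    | succ t ih =>
      intro p
      refine convexHull_min ?_ (convex_convexHull ℝ _) ((hC t).mem_convexHull p)
      rintro _ ⟨q, rfl⟩
      exact ih q
  refine ⟨fun p => ⟨_, hlim p⟩, fun p q a b ha hb => ?_, fun p a ha => ?_⟩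
  · rw [tendsto_nhds_unique ha (hlim p), tendsto_nhds_unique hb (hlim q)]
  · exact (Set.finite_range (x 0)).isClosed_convexHull ℝ |>.mem_of_tendsto ha
      (Eventually.of_forall fun t => hhull t p)

/-- The range `α ≤ 1` includes `α = 1 / (d + 1)` at `d = 0`. -/
theorem Algorithm.achievesConsensusBidirectional_of_isSafe {n d : ℕ} {A : Algorithm.{u} n d}
    {α : ℝ} (hα : 0 < α) (hα' : α ≤ 1) (hC : A.IsConvexCombination) (hS : A.IsSafe α) :
    A.AchievesConsensusBidirectional := fun G s hs hB hG =>
  asymptoticConsensus_of_safe hα hα' (hC G s hs) (hS G s hs) hB hG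

/-- Covers ExtremePoint at `d = 0`, where `1 / (2 * d)` evaluates to `0` and safeness gives no
contraction. -/
theorem AsymptoticConsensus.of_subsingleton {n d : ℕ} [Subsingleton (Space d)]
    (x : ℕ → Fin n → Space d) : AsymptoticConsensus x := by
  refine ⟨fun p => ⟨x 0 p, ?_⟩, fun _ _ _ _ _ _ => Subsingleton.elim _ _, fun p l _ => ?_⟩
  · simpa only [Subsingleton.elim (fun t => x t p) fun _ => x 0 p] using tendsto_const_nhds
  · rw [Subsingleton.elim l (x 0 p)]
    exact subset_convexHull ℝ _ (Set.mem_range_self p)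

/-! ### Convex weights and the ExtremePoint algorithm -/

/-- A point in the convex hull of the received positions is a convex combination of them. -/
theorem exists_weights_of_mem_convexHull {n d : ℕ} {S : Finset (Fin n)} {x : Fin n → Space d}
    {z : Space d} (hz : z ∈ convexHull ℝ (Set.range fun q : S => x q)) :
    ∃ w : Fin n → ℝ, (∀ q ∈ S, 0 ≤ w q) ∧ ∑ q ∈ S, w q = 1 ∧ z = ∑ q ∈ S, w q • x q := by
  classical
  have hconv : Convex ℝ {z : Space d | ∃ w : Fin n → ℝ, (∀ q ∈ S, 0 ≤ w q) ∧
      ∑ q ∈ S, w q = 1 ∧ z = ∑ q ∈ S, w q • x q} := by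
    rintro _ ⟨w, hw, hw1, rfl⟩ _ ⟨w', hw', hw1', rfl⟩ a b ha hb hab
    refine ⟨fun q => a * w q + b * w' q, fun q hq => ?_, ?_, ?_⟩
    · have := hw q hq
      have := hw' q hq
      positivity
    · rw [Finset.sum_add_distrib, ← Finset.mul_sum, ← Finset.mul_sum, hw1, hw1']
      simpa using hab
    · simp only [add_smul, Finset.sum_add_distrib, Finset.smul_sum, smul_smul]
  refine convexHull_min ?_ hconv hz
  rintro _ ⟨q, rfl⟩
  refine ⟨Pi.single q.1 1, fun r _ => ?_, ?_, ?_⟩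
  · by_cases h : r = q.1
    · subst h; simp
    · simp [h]
  · simp [Finset.sum_pi_single']
  · simp [Pi.single_apply, ite_smul]

theorem sum_extremes_eq {n d : ℕ} {S : Finset (Fin n)} (x : Fin n → Space d) (a b : Fin d → S) :
    (1 / (2 * d : ℝ)) • (∑ i, x (a i) + ∑ i, x (b i)) =
      ∑ j : Fin d ⊕ Fin d, (1 / (2 * d : ℝ)) • x ((Sum.elim a b : _ → S) j) := by
  rw [← Finset.smul_sum, Fintype.sum_sum_type]
  simp

theorem extremePoint_isConvexCombination (n d : ℕ) : (extremePoint n d).IsConvexCombination := by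
  intro G (s : ℕ → Fin n → Space d) hs t p
  obtain ⟨a, b, -, -, hy⟩ := hs.2 t p
  refine exists_weights_of_mem_convexHull ?_
  rcases Nat.eq_zero_or_pos d with rfl | hd
  -- At `d = 0` the weights do not sum to `1`, but the space is a single point, so the agent's own
  -- position serves.
  · refine subset_convexHull ℝ _ ⟨⟨p, by simp [CommGraph.inNeighbors, (G _).self_loop p]⟩, ?_⟩
    exact Subsingleton.elim _ _
  · have hy' : (extremePoint n d).positions s (t + 1) p = _ := hy.trans (sum_extremes_eq (s t) a b)
    rw [hy']
    refine (convex_convexHull ℝ _).sum_mem (fun _ _ => by positivity) ?_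
      fun j _ => subset_convexHull ℝ _ ⟨Sum.elim a b j, rfl⟩
    have : (d : ℝ) ≠ 0 := by positivity
    simp
    field_simp
    ring

/-- Of the `2 * d` averaged `i`-th components, one is the maximum and the others are at least the
minimum; symmetrically for the upper bound. -/
theorem extremePoint_isSafe (n d : ℕ) : (extremePoint n d).IsSafe (1 / (2 * d : ℝ)) := by
  intro G (s : ℕ → Fin n → Space d) hs t p i
  set S := (G (t + 1)).inNeighbors p
  obtain ⟨a, b, ha, hb, hy⟩ := hs.2 t p
  have hd : (0 : ℝ) < d := by exact_mod_cast i.pos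
  have hy' : s (t + 1) p i = (1 / (2 * d : ℝ)) * ∑ j : Fin d ⊕ Fin d, s t ((Sum.elim a b : _ → S) j) i := by
    rw [hy, sum_extremes_eq (s t) a b, ← Finset.smul_sum]
    simp [mul_add]
  have hm : minIn (G (t + 1)) (s t) p i = s t (a i) i :=
    le_antisymm (Finset.inf'_le (fun q => s t q i) (a i).2)
      (Finset.le_inf' _ _ fun q hq => ha i ⟨q, hq⟩)
  have hM : maxIn (G (t + 1)) (s t) p i = s t (b i) i :=
    le_antisymm (Finset.sup'_le _ _ fun q hq => hb i ⟨q, hq⟩)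
      (Finset.le_sup' (fun q => s t q i) (b i).2)
  change _ * maxIn (G (t + 1)) (s t) p i + _ * minIn (G (t + 1)) (s t) p i ≤ s (t + 1) p i ∧
    s (t + 1) p i ≤ _ * maxIn (G (t + 1)) (s t) p i + _ * minIn (G (t + 1)) (s t) p i
  rw [hm, hM, hy']
  have h1 := Finset.single_le_sum (s := Finset.univ)
    (f := fun j : Fin d ⊕ Fin d => s t ((Sum.elim a b : _ → S) j) i - s t (a i) i)
    (fun j _ => sub_nonneg.2 (ha i _)) (Finset.mem_univ (Sum.inr i))
  have h2 := Finset.single_le_sum (s := Finset.univ)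
    (f := fun j : Fin d ⊕ Fin d => s t (b i) i - s t ((Sum.elim a b : _ → S) j) i)
    (fun j _ => sub_nonneg.2 (hb i _)) (Finset.mem_univ (Sum.inl i))
  simp only [Finset.sum_sub_distrib, Finset.sum_const, Finset.card_univ, Fintype.card_sum,
    Fintype.card_fin, nsmul_eq_mul, Nat.cast_add, Sum.elim_inl, Sum.elim_inr] at h1 h2
  constructor
  · field_simp
    linarith
  · field_simp
    linarith

theorem extremePoint_achievesConsensusBidirectional (n d : ℕ) :
    (extremePoint n d).AchievesConsensusBidirectional := by
  rcases Nat.eq_zero_or_pos d with rfl | hd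
  · exact fun _ _ _ _ _ => .of_subsingleton _
  · have hd' : (1 : ℝ) ≤ d := by exact_mod_cast hd
    refine Algorithm.achievesConsensusBidirectional_of_isSafe (by positivity) ?_
      (extremePoint_isConvexCombination n d) (extremePoint_isSafe n d)
    rw [div_le_one (by positivity)]
    linarith

/-! ### Hausdorff measure and means of linear functionals on convex sets -/

section Centroid

variable {E : Type*} [NormedAddCommGroup E] [NormedSpace ℝ E] [MeasurableSpace E] [BorelSpace E]

/-- A compact convex set has positive and finite Hausdorff measure in its own dimension. -/
theorem hausdorffMeasure_pos_finite [FiniteDimensional ℝ E] {K : Set E} (hK : IsCompact K)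
    (hc : Convex ℝ K) (hne : K.Nonempty) :
    μH[Module.finrank ℝ (vectorSpan ℝ K)] K ≠ 0 ∧ μH[Module.finrank ℝ (vectorSpan ℝ K)] K ≠ ⊤ := by
  obtain ⟨x₀, hx₀⟩ := hne
  set W : Submodule ℝ E := vectorSpan ℝ K with hW
  -- Translation by `x₀` carries the problem isometrically into the direction space `W`, where the
  -- Hausdorff measure of dimension `finrank W` is a Haar measure and `P` has nonempty interior.
  set f : W → E := fun w => w + x₀ with hf
  have hfi : Isometry f := fun a b => by simp [hf, Subtype.edist_eq]
  set P : Set W := f ⁻¹' K with hP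
  have himg : f '' P = K := by
    refine Set.image_preimage_eq_of_subset fun x hx => ?_
    exact ⟨⟨x - x₀, vsub_mem_vectorSpan ℝ hx hx₀⟩, by simp [hf]⟩
  have hPc : Convex ℝ P := by
    intro a ha b hb s t hs ht hst
    have h := hc ha hb hs ht hst
    have heq : f (s • a + t • b) = s • f a + t • f b := by
      have : x₀ = s • x₀ + t • x₀ := by rw [← add_smul, hst, one_smul]
      simp only [hf, Submodule.coe_add, Submodule.coe_smul, smul_add]
      nth_rewrite 1 [this]
      abel
    simpa only [hP, Set.mem_preimage, heq] using h
  have h0 : (0 : W) ∈ P := by simpa [hP, hf] using hx₀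
  have hPk : IsCompact P := hfi.isClosedEmbedding.isCompact_preimage hK
  have hspan : affineSpan ℝ P = ⊤ := by
    rw [AffineSubspace.affineSpan_eq_top_iff_vectorSpan_eq_top_of_nonempty ℝ W W ⟨0, h0⟩,
      vectorSpan_eq_span_vsub_set_right ℝ h0]
    simp only [vsub_eq_sub, sub_zero, Set.image_id']
    apply Submodule.map_injective_of_injective W.injective_subtype
    rw [Submodule.map_span, Submodule.map_top, Submodule.range_subtype]
    refine Eq.trans ?_ (vectorSpan_eq_span_vsub_set_right ℝ hx₀).symm
    congr 1
    conv_rhs => rw [← himg, Set.image_image]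
    simp [hf]
  have hint := hPc.interior_nonempty_iff_affineSpan_eq_top.2 hspan
  rw [← himg, hfi.hausdorffMeasure_image (Or.inl (Nat.cast_nonneg _))]
  exact ⟨(Measure.measure_pos_of_nonempty_interior _ hint).ne', hPk.measure_lt_top.ne⟩

/-- A convex set shrunk towards a point by the factor `c` stays below the corresponding level of a
linear functional. -/
theorem le_measureReal_level {K : Set E} (hc : Convex ℝ K) {k : ℕ} (hK : μH[k] K ≠ ⊤)
    (f : E →L[ℝ] ℝ) {v : E} (hv : v ∈ K) {M : ℝ} (hM : ∀ x ∈ K, f x ≤ M) {c : ℝ} (hc0 : 0 < c)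
    (hc1 : c ≤ 1) :
    c ^ k * (μH[k]).real K ≤
      ((μH[k]).restrict K).real {x | (1 - c) * (M - f v) ≤ M - f x} := by
  have hmeas : MeasurableSet {x | (1 - c) * (M - f v) ≤ M - f x} :=
    measurableSet_le measurable_const (by fun_prop)
  -- The homothety about `v` keeps `K` inside itself, scales `k`-dimensional measure by `c ^ k`, and
  -- turns `M - f x` into `(1 - c) * (M - f v) + c * (M - f x)`.
  have hsub : AffineMap.homothety v c '' K ⊆ {x | (1 - c) * (M - f v) ≤ M - f x} ∩ K := by
    rintro _ ⟨x, hx, rfl⟩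
    have hx' : AffineMap.homothety v c x = (1 - c) • v + c • x := by
      rw [AffineMap.homothety_apply]
      simp only [vsub_eq_sub, vadd_eq_add, smul_sub, sub_smul, one_smul]
      abel
    rw [hx']
    refine ⟨?_, hc hv hx (by linarith) hc0.le (by ring)⟩
    simp only [Set.mem_ofPred_eq, map_add, map_smul, smul_eq_mul]
    nlinarith [hM x hx]
  rw [measureReal_restrict_apply hmeas]
  refine le_trans (le_of_eq ?_) (measureReal_mono hsub (measure_ne_top_of_subset Set.inter_subset_right hK))
  rw [measureReal_def, measureReal_def, hausdorffMeasure_homothety_image (Nat.cast_nonneg k) v hc0.ne',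
    NNReal.rpow_natCast, ENNReal.smul_def, smul_eq_mul, ENNReal.toReal_mul]
  simp [abs_of_pos hc0]

/-- The mean of `M - f` over a `k`-dimensional convex set is at least the fraction `1 / (k + 1)`
of its largest value. -/
theorem le_setIntegral_sub {K : Set E} (hc : Convex ℝ K) (hKm : MeasurableSet K) {k : ℕ}
    (hK : μH[k] K ≠ ⊤) (f : E →L[ℝ] ℝ) (hint : IntegrableOn f K μH[k]) {v : E} (hv : v ∈ K)
    (hm : ∀ x ∈ K, f v ≤ f x) {M : ℝ} (hM : ∀ x ∈ K, f x ≤ M) :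
    (M - f v) / (k + 1) * (μH[k]).real K ≤ ∫ x in K, (M - f x) ∂μH[k] := by
  have : IsFiniteMeasure ((μH[k]).restrict K) := ⟨by simpa using hK.lt_top⟩
  set L := M - f v with hL
  have hL0 : 0 ≤ L := sub_nonneg.2 (hM v hv)
  have hnn : 0 ≤ᵐ[(μH[k]).restrict K] fun x => M - f x :=
    (ae_restrict_mem hKm).mono fun x hx => sub_nonneg.2 (hM x hx)
  rcases hL0.eq_or_lt with h0 | hLpos
  · rw [← h0]
    simpa using integral_nonneg_of_ae hnn
  have hbd : (fun x => M - f x) ≤ᵐ[(μH[k]).restrict K] fun _ => L :=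
    (ae_restrict_mem hKm).mono fun x hx => sub_le_sub_left (hm x hx) M
  have hint' : Integrable (fun x => M - f x) ((μH[k]).restrict K) := (integrable_const M).sub hint
  -- Layer-cake formula: the integral becomes that of the measures of the sets `{t ≤ M - f}` over `0
  -- < t ≤ L`.
  rw [hint'.integral_eq_integral_Ioc_meas_le hnn hbd, ← intervalIntegral.integral_of_le hL0]
  have hval : ∫ t in (0 : ℝ)..L, ((L - t) / L) ^ k * (μH[k]).real K =
      L / (k + 1) * (μH[k]).real K := by
    rw [intervalIntegral.integral_mul_const]
    congr 1
    simp only [div_pow]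
    rw [intervalIntegral.integral_div, intervalIntegral.integral_comp_sub_left (fun t => t ^ k) L,
      integral_pow]
    simp only [sub_self, sub_zero]
    field_simp
    simp [pow_succ]
  rw [← hval]
  refine intervalIntegral.integral_mono_on_of_le_Ioo hL0 ?_ ?_ fun t ht => ?_
  · exact Continuous.intervalIntegrable (by fun_prop) _ _
  · refine Antitone.intervalIntegrable fun s t hst => ?_
    exact measureReal_mono fun x hx => hst.trans hx
  -- This ratio `c` solves `(1 - c) * L = t`.
  · have h := le_measureReal_level hc hK f hv hM (c := (L - t) / L)
      (div_pos (sub_pos.2 ht.2) hLpos) (by rw [div_le_one hLpos]; linarith [ht.1])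
    rwa [show (1 - (L - t) / L) * (M - f v) = t by rw [← hL]; field_simp; ring] at h

end Centroid

/-! ### The Centroid algorithm -/

theorem integrableOn_of_isCompact {d : ℕ} {K : Set (Space d)} (hK : IsCompact K)
    {μ : Measure (Space d)} (hμ : μ K ≠ ⊤) : IntegrableOn (fun z => z) K μ :=
  continuousOn_id.integrableOn_of_subset_isCompact hK hK.measurableSet subset_rfl hμ

theorem uniformCentroid_mem {d : ℕ} {K : Set (Space d)} (hK : IsCompact K) (hc : Convex ℝ K)
    (hne : K.Nonempty) : uniformCentroid K ∈ K := by
  obtain ⟨h0, ht⟩ := hausdorffMeasure_pos_finite hK hc hne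
  exact hc.set_average_mem hK.isClosed h0 ht (ae_restrict_mem hK.measurableSet)
    (integrableOn_of_isCompact hK ht)

/-- The centroid of a convex body in `ℝ^d` lies at least the fraction `1 / (d + 1)` of the width
below the maximum of each linear functional. -/
theorem uniformCentroid_le {d : ℕ} {K : Set (Space d)} (hK : IsCompact K) (hc : Convex ℝ K)
    (f : Space d →L[ℝ] ℝ) {v : Space d} (hv : v ∈ K)
    (hm : ∀ x ∈ K, f v ≤ f x) {M : ℝ} (hM : ∀ x ∈ K, f x ≤ M) :
    f (uniformCentroid K) ≤ M - 1 / (d + 1) * (M - f v) := by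
  obtain ⟨h0, ht⟩ := hausdorffMeasure_pos_finite hK hc ⟨v, hv⟩
  set k := Module.finrank ℝ (vectorSpan ℝ K) with hk
  have hkd : (k : ℝ) ≤ d := by
    have := Submodule.finrank_le (vectorSpan ℝ K)
    rw [finrank_euclideanSpace_fin] at this
    exact_mod_cast this
  have hid := integrableOn_of_isCompact hK ht
  have hfi : IntegrableOn f K μH[k] := f.integrable_comp hid
  have key := le_setIntegral_sub hc hK.measurableSet ht f hfi hv hm hM
  have hpos : 0 < (μH[k]).real K := ENNReal.toReal_pos h0 ht
  have : IsFiniteMeasure ((μH[k] : Measure (Space d)).restrict K) := ⟨by simpa using ht.lt_top⟩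
  rw [integral_sub (integrable_const M) hfi, setIntegral_const, smul_eq_mul] at key
  have hcent : f (uniformCentroid K) = ((μH[k]).real K)⁻¹ * ∫ x in K, f x ∂μH[k] := by
    rw [uniformCentroid, setAverage_eq, map_smul, smul_eq_mul, ← hk]
    congr 1
    exact (f.integral_comp_comm hid).symm
  have hL : 0 ≤ M - f v := sub_nonneg.2 (hM v hv)
  have h1 : f (uniformCentroid K) ≤ M - (M - f v) / (k + 1) := by
    rw [hcent, inv_mul_le_iff₀ hpos]
    linarith
  -- The hull may have any dimension `k ≤ d`; the worst fraction is that of `k = d`.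
  have h2 : 1 / (d + 1) * (M - f v) ≤ (M - f v) / (k + 1) := by
    rw [one_div_mul_eq_div]
    gcongr
  linarith

theorem isCompact_hull_received {n d : ℕ} (S : Finset (Fin n)) (x : Fin n → Space d) :
    IsCompact (convexHull ℝ (Set.range fun q : S => x q)) :=
  (Set.finite_range _).isCompact_convexHull ℝ

theorem le_of_mem_convexHull_of_forall_le {d : ℕ} {s : Set (Space d)} (f : Space d →L[ℝ] ℝ) {M : ℝ}
    (h : ∀ x ∈ s, f x ≤ M) : ∀ x ∈ convexHull ℝ s, f x ≤ M := fun _ hx =>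
  convexHull_min h (convex_halfSpace_le f.toLinearMap.isLinear M) hx

theorem uniformCentroid_convexHull_le {n d : ℕ} {S : Finset (Fin n)} (x : Fin n → Space d)
    (f : Space d →L[ℝ] ℝ) {a b : S} (ha : ∀ q : S, f (x a) ≤ f (x q))
    (hb : ∀ q : S, f (x q) ≤ f (x b)) :
    f (uniformCentroid (convexHull ℝ (Set.range fun q : S => x q))) ≤
      (1 - 1 / (d + 1)) * f (x b) + 1 / (d + 1) * f (x a) := by
  have h := uniformCentroid_le (isCompact_hull_received S x) (convex_convexHull ℝ _) f
    (subset_convexHull ℝ _ ⟨a, rfl⟩)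
    (fun z hz => neg_le_neg_iff.1 (le_of_mem_convexHull_of_forall_le (-f) (M := -f (x a))
      (by rintro _ ⟨q, rfl⟩; exact neg_le_neg (ha q)) z hz))
    (le_of_mem_convexHull_of_forall_le f (M := f (x b)) (by rintro _ ⟨q, rfl⟩; exact hb q))
  linarith

theorem centroidAlgorithm_isConvexCombination (n d : ℕ) :
    (centroidAlgorithm n d).IsConvexCombination := by
  intro G (s : ℕ → Fin n → Space d) hs t p
  have hy : s (t + 1) p = uniformCentroid _ := hs.2 t p
  refine exists_weights_of_mem_convexHull ?_
  change s (t + 1) p ∈ _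
  rw [hy]
  refine uniformCentroid_mem (isCompact_hull_received _ (s t)) (convex_convexHull ℝ _) ?_
  exact ⟨_, subset_convexHull ℝ _
    ⟨⟨p, by simp [CommGraph.inNeighbors, (G _).self_loop p]⟩, rfl⟩⟩

theorem centroidAlgorithm_isSafe (n d : ℕ) :
    (centroidAlgorithm n d).IsSafe (1 / (d + 1 : ℝ)) := by
  intro G (s : ℕ → Fin n → Space d) hs t p i
  have hy : s (t + 1) p = uniformCentroid _ := hs.2 t p
  have hne := (G (t + 1)).inNeighbors_nonempty p
  obtain ⟨a, ha, ham⟩ := Finset.exists_mem_eq_inf' hne fun q => s t q i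
  obtain ⟨b, hb, hbM⟩ := Finset.exists_mem_eq_sup' hne fun q => s t q i
  have ha' : ∀ q : (G (t + 1)).inNeighbors p, s t a i ≤ s t q i := fun q =>
    ham ▸ Finset.inf'_le (fun q => s t q i) q.2
  have hb' : ∀ q : (G (t + 1)).inNeighbors p, s t q i ≤ s t b i := fun q =>
    hbM ▸ Finset.le_sup' (fun q => s t q i) q.2
  change _ * maxIn (G (t + 1)) (s t) p i + _ * minIn (G (t + 1)) (s t) p i ≤ s (t + 1) p i ∧
    s (t + 1) p i ≤ _ * maxIn (G (t + 1)) (s t) p i + _ * minIn (G (t + 1)) (s t) p i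
  rw [show minIn (G (t + 1)) (s t) p i = _ from ham, show maxIn (G (t + 1)) (s t) p i = _ from hbM,
    hy]
  have h1 := uniformCentroid_convexHull_le (s t) (EuclideanSpace.proj i : Space d →L[ℝ] ℝ)
    (a := ⟨a, ha⟩) (b := ⟨b, hb⟩) ha' hb'
  -- The lower bound is the upper bound for the negated coordinate, with the two extreme agents
  -- exchanged.
  have h2 := uniformCentroid_convexHull_le (s t) (-(EuclideanSpace.proj i : Space d →L[ℝ] ℝ))
    (a := ⟨b, hb⟩) (b := ⟨a, ha⟩) (fun q => neg_le_neg (hb' q)) fun q => neg_le_neg (ha' q)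
  simp only [_root_.neg_apply, PiLp.proj_apply] at h1 h2
  exact ⟨by linarith, h1⟩

theorem centroidAlgorithm_achievesConsensusBidirectional (n d : ℕ) :
    (centroidAlgorithm n d).AchievesConsensusBidirectional := by
  refine Algorithm.achievesConsensusBidirectional_of_isSafe (by positivity) ?_
    (centroidAlgorithm_isConvexCombination n d) (centroidAlgorithm_isSafe n d)
  rw [div_le_one (by positivity)]
  simp

end Consensus

theorem theorem6 (n d : ℕ) :
    (∀ (A : Consensus.Algorithm.{u} n d) (α : ℝ), 0 < α → α ≤ 1 / 2 →
      A.IsConvexCombination → A.IsSafe α → A.AchievesConsensusBidirectional) ∧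
    ((Consensus.extremePoint n d).IsConvexCombination ∧
      (Consensus.extremePoint n d).IsSafe (1 / (2 * d : ℝ)) ∧
      (Consensus.extremePoint n d).AchievesConsensusBidirectional) ∧
    ((Consensus.centroidAlgorithm n d).IsConvexCombination ∧
      (Consensus.centroidAlgorithm n d).IsSafe (1 / (d + 1 : ℝ)) ∧
      (Consensus.centroidAlgorithm n d).AchievesConsensusBidirectional) := by
  refine ⟨fun A α hα hα' hC hS => Consensus.Algorithm.achievesConsensusBidirectional_of_isSafe hα
    (hα'.trans (by norm_num)) hC hS, ⟨?_, ?_, ?_⟩, ?_, ?_, ?_⟩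
  · exact Consensus.extremePoint_isConvexCombination n d
  · exact Consensus.extremePoint_isSafe n d
  · exact Consensus.extremePoint_achievesConsensusBidirectional n d
  · exact Consensus.centroidAlgorithm_isConvexCombination n d
  · exact Consensus.centroidAlgorithm_isSafe n d
  · exact Consensus.centroidAlgorithm_achievesConsensusBidirectional n d
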